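/- A set $M\subseteq\mathbb R^m$ is semialgebraic if it is a finite union of sets of the form $\{x\in\mathbb R^m: f(x)=0,\ g_1(x)>0,\dots,g_\ell(x)>0\}$ with $f,g_1,\dots,g_\ell$ real polynomials. A semialgebraic map $\pi:M\to N$ between semialgebraic sets $M\subseteq\mathbb R^m$, $N\subseteq\mathbb R^n$ is a continuous map whose graph is semialgebraic. Let $\mathcal S(M)$ be the ring of continuous functions $M\to\mathbb R$ with semialgebraic graph, let $\operatorname{Spec}_s(M)$ be its prime spectrum with the Zariski topology, let $\beta_sM\subseteq\operatorname{Spec}_s(M)$ be the subspace of maximal ideals, and let $j_M:M\to\beta_sM$ be the map $x\mapsto\mathfrak m_x=\{f\in\mathcal S(M): f(x)=0\}$. A semialgebraic map $\pi:M\to N$ induces the ring homomorphism $\varphi_\pi:\mathcal S(N)\to\mathcal S(M)$, $f\mapsto f\circ\pi$, and the map $\operatorname{Spec}_s(\pi):\operatorname{Spec}_s(M)\to\operatorname{Spec}_s(N)$, $\mathfrak p\mapsto\varphi_\pi^{-1}(\mathfrak p)$. A map is proper if it is continuous and closed with compact fibers. Proposition. Let $\pi:M\to N$ be a semialgebraic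 map between semialgebraic sets such that $\varphi_\pi:\mathcal S(N)\to\mathcal S(M)$ is integral. Then: (1) $\operatorname{Spec}_s(\pi):\operatorname{Spec}_s(M)\to\operatorname{Spec}_s(N)$ is proper and separated, that is, its fibers are Hausdorff spaces. (2) $\operatorname{Spec}_s(\pi)$ maps maximal ideals of $\mathcal S(M)$ to maximal ideals of $\mathcal S(N)$. Thus the restriction $\beta_s\pi:=\operatorname{Spec}_s(\pi)|_{\beta_sM}:\beta_sM\to\beta_sN$ is well defined; it is a proper map, and it is the unique continuous map $\beta_sM\to\beta_sN$ satisfying $\beta_s\pi\circ j_M=j_N\circ\pi$. (3) The map $\pi:M\to N$ is proper with finite fibers. -/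

import Mathlib

/-- A basic semialgebraic subset `{f = 0, g₁ > 0, …, g_ℓ > 0}` of `ℝ^σ`. -/
def IsBasicSemialgebraic {σ : Type*} (S : Set (σ → ℝ)) : Prop :=
  ∃ (f : MvPolynomial σ ℝ) (g : Finset (MvPolynomial σ ℝ)),
    S = {x | MvPolynomial.eval x f = 0 ∧ ∀ q ∈ g, 0 < MvPolynomial.eval x q}

/-- A semialgebraic subset of `ℝ^σ`: a finite union of basic semialgebraic sets. -/
def IsSemialgebraic {σ : Type*} (S : Set (σ → ℝ)) : Prop :=
  ∃ 𝒞 : Set (Set (σ → ℝ)), 𝒞.Finite ∧ (∀ B ∈ 𝒞, IsBasicSemialgebraic B) ∧ S = ⋃₀ 𝒞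

namespace Semialg

open Polynomial Set Filter

/-- An increasing bijection of the real line carrying the signs of `q` to those of `q'`. -/
def SignMatch (h : ℝ ≃o ℝ) (q q' : ℝ[X]) : Prop :=
  ∀ y, SignType.sign (q.eval y) = SignType.sign (q'.eval (h y))

theorem sign_eq_zero_iff' {a b : ℝ} (h : SignType.sign a = SignType.sign b) : a = 0 ↔ b = 0 := by
  rw [← sign_eq_zero_iff, h, sign_eq_zero_iff]

theorem sign_neg_iff {a b : ℝ} (h : SignType.sign a = SignType.sign b) : a < 0 ↔ b < 0 := by
  rw [← sign_eq_neg_one_iff, h, sign_eq_neg_one_iff]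

theorem exists_tent {a b u v : ℝ} (hu : u ∈ Ioo a b) (hv : v ∈ Ioo a b) :
    ∃ ψ : ℝ ≃o ℝ, ψ u = v ∧ ∀ y, y ∉ Ioo a b → ψ y = y := by
  obtain ⟨hau, hub⟩ := hu
  obtain ⟨hav, hvb⟩ := hv
  have h1 : 0 < u - a := by linarith
  have h2 : 0 < b - u := by linarith
  let f : ℝ → ℝ := fun y =>
    if y ≤ a then y else if y ≤ u then a + (v - a) / (u - a) * (y - a)
      else if y ≤ b then b - (b - v) / (b - u) * (b - y) else y
  have hc : 0 < (v - a) / (u - a) := div_pos (by linarith) h1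
  have hd : 0 < (b - v) / (b - u) := div_pos (by linarith) h2
  have ec : (v - a) / (u - a) * (u - a) = v - a := by field_simp
  have ed : (b - v) / (b - u) * (b - u) = b - v := by field_simp
  have hmono : StrictMono f := by
    intro x y hxy
    simp only [f]
    split_ifs <;> nlinarith
  have hsurj : Function.Surjective f := by
    intro y
    have ec' : (v - a) / (u - a) * ((u - a) / (v - a)) = 1 := by
      have : v - a ≠ 0 := by linarith
      field_simp
    have ed' : (b - v) / (b - u) * ((b - u) / (b - v)) = 1 := by
      have : b - v ≠ 0 := by linarith
      field_simp
    rcases le_or_gt y a with hy | hy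
    · exact ⟨y, by simp [f, hy]⟩
    rcases le_or_gt y v with hy2 | hy2
    · have e : (u - a) / (v - a) * (v - a) = u - a := by
        have : v - a ≠ 0 := by linarith
        field_simp
      have hp : 0 < (u - a) / (v - a) := div_pos h1 (by linarith)
      refine ⟨a + (u - a) / (v - a) * (y - a), ?_⟩
      have i1 : ¬ a + (u - a) / (v - a) * (y - a) ≤ a := by nlinarith
      have i2 : a + (u - a) / (v - a) * (y - a) ≤ u := by nlinarith
      simp only [f, if_neg i1, if_pos i2]
      linear_combination (y - a) * ec'
    rcases le_or_gt y b with hy3 | hy3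
    · have e : (b - u) / (b - v) * (b - v) = b - u := by
        have : b - v ≠ 0 := by linarith
        field_simp
      have hp : 0 < (b - u) / (b - v) := div_pos h2 (by linarith)
      refine ⟨b - (b - u) / (b - v) * (b - y), ?_⟩
      have i2 : ¬ b - (b - u) / (b - v) * (b - y) ≤ u := by nlinarith
      have i1 : ¬ b - (b - u) / (b - v) * (b - y) ≤ a := by linarith
      have i3 : b - (b - u) / (b - v) * (b - y) ≤ b := by nlinarith
      simp only [f, if_neg i1, if_neg i2, if_pos i3]
      linear_combination -(b - y) * ed'
    · refine ⟨y, ?_⟩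
      simp only [f, if_neg (not_le.2 hy), if_neg (not_le.2 (hub.trans hy3)),
        if_neg (not_le.2 hy3)]
  refine ⟨hmono.orderIsoOfSurjective f hsurj, ?_, ?_⟩
  · simp only [StrictMono.coe_orderIsoOfSurjective, f, if_neg (not_le.2 hau), le_refl, if_true]
    linarith
  · intro y hy
    simp only [StrictMono.coe_orderIsoOfSurjective, f]
    by_cases h : y ≤ a
    · simp [h]
    · have : b ≤ y := by
        by_contra hb
        exact hy ⟨not_le.1 h, not_le.1 hb⟩
      rw [if_neg h, if_neg (by linarith)]
      split_ifs with hb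
      · have : y = b := le_antisymm hb this
        subst this; ring
      · rfl

theorem exists_root_Ioo (p : ℝ[X]) {a b : ℝ} (hab : a < b) (h : p.eval a * p.eval b < 0) :
    ∃ v ∈ Ioo a b, p.eval v = 0 := by
  rcases mul_neg_iff.1 h with ⟨h1, h2⟩ | ⟨h1, h2⟩
  · exact intermediate_value_Ioo' hab.le p.continuous.continuousOn ⟨h2, h1⟩
  · exact intermediate_value_Ioo hab.le p.continuous.continuousOn ⟨h1, h2⟩

theorem strictMono_or_anti (p : ℝ[X]) {a b : ℝ}
    (h : ∀ y ∈ Ioo a b, p.derivative.eval y ≠ 0) :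
    StrictMonoOn (fun y => p.eval y) (Icc a b) ∨ StrictAntiOn (fun y => p.eval y) (Icc a b) := by
  have key : (∀ y ∈ Ioo a b, 0 < p.derivative.eval y) ∨
      ∀ y ∈ Ioo a b, p.derivative.eval y < 0 := by
    by_contra hcon
    push Not at hcon
    obtain ⟨⟨x, hx, hx0⟩, y, hy, hy0⟩ := hcon
    have hx1 := lt_of_le_of_ne hx0 (h x hx)
    have hy1 := lt_of_le_of_ne hy0 (h y hy).symm
    rcases lt_trichotomy x y with hxy | hxy | hxy
    · obtain ⟨v, hv, hv0⟩ := exists_root_Ioo p.derivative hxy (mul_neg_of_neg_of_pos hx1 hy1)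
      exact h v ⟨hx.1.trans hv.1, hv.2.trans hy.2⟩ hv0
    · subst hxy; linarith
    · obtain ⟨v, hv, hv0⟩ := exists_root_Ioo p.derivative hxy (mul_neg_of_pos_of_neg hy1 hx1)
      exact h v ⟨hy.1.trans hv.1, hv.2.trans hx.2⟩ hv0
  rcases key with key | key
  · left
    refine strictMonoOn_of_deriv_pos (convex_Icc a b) p.continuous.continuousOn ?_
    simpa [interior_Icc] using fun y h1 h2 => key y ⟨h1, h2⟩
  · right
    refine strictAntiOn_of_deriv_neg (convex_Icc a b) p.continuous.continuousOn ?_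
    simpa [interior_Icc] using fun y h1 h2 => key y ⟨h1, h2⟩

theorem sign_in_gap (p : ℝ[X]) {a b y : ℝ} (hy : y ∈ Ioo a b)
    (h : ∀ y ∈ Ioo a b, p.derivative.eval y ≠ 0) (hp : 0 ≤ p.eval a * p.eval b) :
    SignType.sign (p.eval y) = if SignType.sign (p.eval a) = 0 then SignType.sign (p.eval b)
      else SignType.sign (p.eval a) := by
  have hab := hy.1.trans hy.2
  have ma : a ∈ Icc a b := ⟨le_rfl, hab.le⟩
  have mb : b ∈ Icc a b := ⟨hab.le, le_rfl⟩
  have my : y ∈ Icc a b := ⟨hy.1.le, hy.2.le⟩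
  rcases strictMono_or_anti p h with hm | hm
  · have h1 : p.eval a < p.eval y := hm ma my hy.1
    have h2 : p.eval y < p.eval b := hm my mb hy.2
    rcases lt_trichotomy (p.eval a) 0 with h3 | h3 | h3
    · have h4 : p.eval y < 0 := by nlinarith
      simp [sign_neg h3, sign_neg h4]
    · have h4 : 0 < p.eval y := by linarith
      have h5 : 0 < p.eval b := by linarith
      simp [h3, sign_pos h4, sign_pos h5]
    · simp [sign_pos h3, sign_pos (h3.trans h1)]
  · have h1 : p.eval y < p.eval a := hm ma my hy.1
    have h2 : p.eval b < p.eval y := hm my mb hy.2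
    rcases lt_trichotomy (p.eval a) 0 with h3 | h3 | h3
    · have h4 : p.eval y < 0 := by linarith
      simp [sign_neg h3, sign_neg h4]
    · have h4 : p.eval y < 0 := by linarith
      have h5 : p.eval b < 0 := by linarith
      simp [h3, sign_neg h4, sign_neg h5]
    · have h4 : 0 < p.eval y := by nlinarith
      simp [sign_pos h3, sign_pos h4]

theorem exists_gap {Z : Set ℝ} (hZ : IsClosed Z) (hlo : ∀ r, ∃ z ∈ Z, z < r)
    (hhi : ∀ r, ∃ z ∈ Z, r < z) {r : ℝ} (hr : r ∉ Z) :
    ∃ a ∈ Z, ∃ b ∈ Z, r ∈ Ioo a b ∧ ∀ z ∈ Z, z ∉ Ioo a b := by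
  have c1 : IsClosed (Z ∩ Iic r) := hZ.inter isClosed_Iic
  have c2 : IsClosed (Z ∩ Ici r) := hZ.inter isClosed_Ici
  have n1 : (Z ∩ Iic r).Nonempty := let ⟨z, h1, h2⟩ := hlo r; ⟨z, h1, h2.le⟩
  have n2 : (Z ∩ Ici r).Nonempty := let ⟨z, h1, h2⟩ := hhi r; ⟨z, h1, h2.le⟩
  have b1 : BddAbove (Z ∩ Iic r) := ⟨r, fun z hz => hz.2⟩
  have b2 : BddBelow (Z ∩ Ici r) := ⟨r, fun z hz => hz.2⟩
  have m1 := c1.csSup_mem n1 b1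
  have m2 := c2.csInf_mem n2 b2
  refine ⟨_, m1.1, _, m2.1, ⟨lt_of_le_of_ne m1.2 fun h => hr (h ▸ m1.1),
    lt_of_le_of_ne m2.2 fun h => hr (h ▸ m2.1)⟩, ?_⟩
  intro z hz hz'
  rcases le_total z r with h | h
  · exact absurd (le_csSup b1 ⟨hz, h⟩) (not_le.2 hz'.1)
  · exact absurd (csInf_le b2 ⟨hz, h⟩) (not_le.2 hz'.2)

theorem signMatch_zero {h : ℝ ≃o ℝ} {q q' : ℝ[X]} (hq : SignMatch h q q') : q = 0 ↔ q' = 0 := by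
  constructor
  · rintro rfl
    refine Polynomial.funext fun y => ?_
    have := hq (h.symm y)
    simp only [OrderIso.apply_symm_apply, eval_zero, sign_zero] at this
    simpa using sign_eq_zero_iff.1 this.symm
  · rintro rfl
    refine Polynomial.funext fun y => ?_
    have := hq y
    simpa using this

/-- Inserting a root of `p` in the set on which the signs of `p` and `P` are matched. -/
theorem insert_root {L : Set (ℝ[X] × ℝ[X])} {p P : ℝ[X]} {Z : Set ℝ} {h : ℝ ≃o ℝ}
    (hL : ∀ q ∈ L, SignMatch h q.1 q.2) (hd : (derivative p, derivative P) ∈ L)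
    (hd0 : derivative p ≠ 0) (hZ : IsClosed Z)
    (hlo : ∀ r, ∃ z ∈ Z, z < r) (hhi : ∀ r, ∃ z ∈ Z, r < z)
    (hroot : ∀ q ∈ L, q.1 ≠ 0 → ∀ y, q.1.eval y = 0 → y ∈ Z)
    (hp : ∀ z ∈ Z, SignType.sign (p.eval z) = SignType.sign (P.eval (h z)))
    {r : ℝ} (hr : p.eval r = 0) :
    ∃ h' : ℝ ≃o ℝ, (∀ q ∈ L, SignMatch h' q.1 q.2) ∧
      ∀ z ∈ insert r Z, SignType.sign (p.eval z) = SignType.sign (P.eval (h' z)) := by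
  by_cases hrZ : r ∈ Z
  · exact ⟨h, hL, by rwa [insert_eq_of_mem hrZ]⟩
  obtain ⟨a, ha, b, hb, hrab, hgap⟩ := exists_gap hZ hlo hhi hrZ
  have hab := hrab.1.trans hrab.2
  have hne : ∀ y ∈ Ioo a b, p.derivative.eval y ≠ 0 := fun y hy h0 =>
    hgap y (hroot _ hd hd0 y h0) hy
  have hneg : p.eval a * p.eval b < 0 := by
    have ma : a ∈ Icc a b := ⟨le_rfl, hab.le⟩
    have mb : b ∈ Icc a b := ⟨hab.le, le_rfl⟩
    have my : r ∈ Icc a b := ⟨hrab.1.le, hrab.2.le⟩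
    rcases strictMono_or_anti p hne with hm | hm
    · have h1 : p.eval a < p.eval r := hm ma my hrab.1
      have h2 : p.eval r < p.eval b := hm my mb hrab.2
      nlinarith
    · have h1 : p.eval r < p.eval a := hm ma my hrab.1
      have h2 : p.eval b < p.eval r := hm my mb hrab.2
      nlinarith
  have hneg' : P.eval (h a) * P.eval (h b) < 0 := by
    refine (sign_neg_iff ?_).1 hneg
    rw [sign_mul, sign_mul, hp a ha, hp b hb]
  obtain ⟨v, hv, hv0⟩ := exists_root_Ioo P (h.strictMono hab) hneg'
  obtain ⟨ψ, hψ, hψ'⟩ := exists_tent (u := h r)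
    ⟨h.strictMono hrab.1, h.strictMono hrab.2⟩ hv
  have hmaps : ∀ y ∈ Ioo a b, ψ (h y) ∈ Ioo (h a) (h b) := by
    intro y hy
    have e1 : ψ (h a) = h a := hψ' _ (by simp)
    have e2 : ψ (h b) = h b := hψ' _ (by simp)
    constructor
    · rw [← e1]; exact ψ.strictMono (h.strictMono hy.1)
    · rw [← e2]; exact ψ.strictMono (h.strictMono hy.2)
  have hout : ∀ y, y ∉ Ioo a b → ψ (h y) = h y := by
    intro y hy
    refine hψ' _ fun hm => hy ⟨h.lt_iff_lt.1 hm.1, h.lt_iff_lt.1 hm.2⟩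
  refine ⟨h.trans ψ, ?_, ?_⟩
  · intro q hq y
    rw [hL q hq y]
    simp only [OrderIso.trans_apply]
    by_cases hy : y ∈ Ioo a b
    · have key : ∀ w ∈ Ioo (h a) (h b), q.1 ≠ 0 → q.2.eval w ≠ 0 := by
        intro w hw hq0 hw0
        have h1 := hL q hq (h.symm w)
        rw [OrderIso.apply_symm_apply, hw0, sign_zero, sign_eq_zero_iff] at h1
        refine hgap _ (hroot q hq hq0 _ h1) ⟨?_, ?_⟩
        · exact h.lt_iff_lt.1 (by simpa using hw.1)
        · exact h.lt_iff_lt.1 (by simpa using hw.2)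
      by_cases hq0 : q.1 = 0
      · rw [(signMatch_zero (hL q hq)).1 hq0]; simp
      have main : ∀ w ∈ Ioo (h a) (h b), ∀ w' ∈ Ioo (h a) (h b), w ≤ w' →
          SignType.sign (q.2.eval w) = SignType.sign (q.2.eval w') := by
        intro w hw w' hw' hle
        rcases hle.eq_or_lt with rfl | hlt
        · rfl
        by_contra hne
        have hmul : q.2.eval w * q.2.eval w' < 0 := by
          have n1 := key w hw hq0
          have n2 := key w' hw' hq0
          rcases lt_or_gt_of_ne n1 with h1 | h1 <;> rcases lt_or_gt_of_ne n2 with h2 | h2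
          · exact absurd (by rw [sign_neg h1, sign_neg h2]) hne
          · exact mul_neg_of_neg_of_pos h1 h2
          · exact mul_neg_of_pos_of_neg h1 h2
          · exact absurd (by rw [sign_pos h1, sign_pos h2]) hne
        obtain ⟨t, ht, ht0⟩ := exists_root_Ioo q.2 hlt hmul
        exact key t ⟨hw.1.trans ht.1, ht.2.trans hw'.2⟩ hq0 ht0
      have m1 : h y ∈ Ioo (h a) (h b) := ⟨h.strictMono hy.1, h.strictMono hy.2⟩
      rcases le_total (h y) (ψ (h y)) with hle | hle
      · exact main _ m1 _ (hmaps y hy) hle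
      · exact (main _ (hmaps y hy) _ m1 hle).symm
    · rw [hout y hy]
  · rintro z (rfl | hz)
    · simp [hr, hψ, hv0]
    · simp only [OrderIso.trans_apply]
      rw [hout z (hgap z hz), hp z hz]

theorem eventually_sign (p : ℝ[X]) (hp : derivative p ≠ 0) :
    ∀ᶠ y in atTop, SignType.sign (p.eval y) = SignType.sign (p.derivative.eval y) := by
  have hdeg : 0 < p.natDegree := by
    by_contra h0
    exact hp (derivative_of_natDegree_zero (by omega))
  have hp0 : p ≠ 0 := by rintro rfl; simp at hp
  have h1 : 0 < (p * derivative p).degree := by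
    rw [← natDegree_pos_iff_degree_pos, natDegree_mul hp0 hp]; omega
  have h2 : 0 ≤ (p * derivative p).leadingCoeff := by
    have : (derivative p).leadingCoeff = p.leadingCoeff * p.natDegree := by
      rw [leadingCoeff, natDegree_derivative, coeff_derivative, Nat.sub_add_cancel hdeg]
      have : ((p.natDegree - 1 : ℕ) : ℝ) + 1 = p.natDegree := by
        rw [Nat.cast_sub hdeg]; simp
      rw [this, leadingCoeff]
    rw [leadingCoeff_mul, this, ← mul_assoc]
    exact mul_nonneg (mul_self_nonneg _) (Nat.cast_nonneg _)
  filter_upwards [(tendsto_atTop_of_leadingCoeff_nonneg _ h1 h2).eventually_gt_atTop 0] with y hy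
  rw [eval_mul] at hy
  rcases mul_pos_iff.1 hy with ⟨h3, h4⟩ | ⟨h3, h4⟩
  · rw [sign_pos h3, sign_pos h4]
  · rw [sign_neg h3, sign_neg h4]

theorem eventually_sign_bot (p : ℝ[X]) (hp : derivative p ≠ 0) :
    ∀ᶠ y in atBot, SignType.sign (p.eval y) = - SignType.sign (p.derivative.eval y) := by
  have h0 : derivative (p.comp (-X)) = -((derivative p).comp (-X)) := by
    simp [derivative_comp]
  have h1 : derivative (p.comp (-X)) ≠ 0 := by
    rw [h0, neg_ne_zero]
    intro h
    apply hp
    have := congrArg (fun q : ℝ[X] => q.comp (-X)) h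
    simpa [comp_assoc] using this
  have := tendsto_neg_atBot_atTop.eventually (eventually_sign _ h1)
  filter_upwards [this] with y hy
  rw [h0] at hy
  simpa [eval_comp, Left.sign_neg] using hy

/-- Extending a sign matching to a further pair of polynomials. -/
theorem match_extend {L : Set (ℝ[X] × ℝ[X])} (hfin : L.Finite) {p P : ℝ[X]} {h : ℝ ≃o ℝ}
    (hL : ∀ q ∈ L, SignMatch h q.1 q.2) (hd : (derivative p, derivative P) ∈ L)
    (hd0 : derivative p ≠ 0)
    (hp : ∀ q ∈ L, q.1 ≠ 0 → ∀ y, q.1.eval y = 0 →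
      SignType.sign (p.eval y) = SignType.sign (P.eval (h y))) :
    ∃ h' : ℝ ≃o ℝ, (∀ q ∈ L, SignMatch h' q.1 q.2) ∧ SignMatch h' p P := by
  have hd0' : derivative P ≠ 0 := fun h0 => hd0 ((signMatch_zero (hL _ hd)).2 h0)
  have hp0 : p ≠ 0 := by rintro rfl; simp at hd0
  obtain ⟨B, hB⟩ : ∃ B, ∀ y ≥ B, SignType.sign (p.eval y) = SignType.sign (P.eval (h y)) := by
    refine eventually_atTop.1 ?_
    filter_upwards [eventually_sign p hd0,
      h.tendsto_atTop.eventually (eventually_sign P hd0')] with y h1 h2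
    rw [h1, h2]; exact hL _ hd y
  obtain ⟨A, hA⟩ : ∃ A, ∀ y ≤ A, SignType.sign (p.eval y) = SignType.sign (P.eval (h y)) := by
    refine eventually_atBot.1 ?_
    filter_upwards [eventually_sign_bot p hd0,
      h.tendsto_atBot.eventually (eventually_sign_bot P hd0')] with y h1 h2
    rw [h1, h2]; exact congrArg _ (hL _ hd y)
  let Z0 : Set ℝ := ⋃ q ∈ L, {y | q.1 ≠ 0 ∧ q.1.eval y = 0}
  have hZ0 : Z0.Finite := by
    refine hfin.biUnion fun q _ => ?_
    by_cases hq : q.1 = 0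
    · simp [hq]
    · refine (q.1.roots.toFinset.finite_toSet).subset ?_
      rintro y ⟨_, hy⟩
      simp [hq, hy]
  let Z1 : Set ℝ := Z0 ∪ (Iic A ∪ Ici B)
  have hZ1 : IsClosed Z1 := hZ0.isClosed.union (isClosed_Iic.union isClosed_Ici)
  have key : ∀ R : Finset ℝ, (∀ r ∈ R, p.eval r = 0) →
      ∃ h' : ℝ ≃o ℝ, (∀ q ∈ L, SignMatch h' q.1 q.2) ∧
        ∀ z ∈ Z1 ∪ (R : Set ℝ), SignType.sign (p.eval z) = SignType.sign (P.eval (h' z)) := by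
    intro R
    induction R using Finset.induction_on with
    | empty =>
      refine fun _ => ⟨h, hL, ?_⟩
      rintro z ((hz | hz | hz) | hz)
      · simp only [Z0, mem_iUnion] at hz
        obtain ⟨q, hq, h1, h2⟩ := hz
        exact hp q hq h1 z h2
      · exact hA z hz
      · exact hB z hz
      · simp at hz
    | insert r R _ ih =>
      intro hR
      obtain ⟨h1, hL1, hZ⟩ := ih fun r hr => hR r (by simp [hr])
      obtain ⟨h2, hL2, hZ2⟩ := insert_root (Z := Z1 ∪ (R : Set ℝ)) hL1 hd hd0
        (hZ1.union R.finite_toSet.isClosed)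
        (fun r => ⟨min A (r - 1), Or.inl (Or.inr (Or.inl (mem_Iic.2 (min_le_left _ _)))),
          (min_le_right _ _).trans_lt (by linarith)⟩)
        (fun r => ⟨max B (r + 1), Or.inl (Or.inr (Or.inr (mem_Ici.2 (le_max_left _ _)))),
          lt_of_lt_of_le (by linarith) (le_max_right _ _)⟩)
        (fun q hq h0 y hy => Or.inl (Or.inl (mem_biUnion hq ⟨h0, hy⟩)))
        hZ (hR r (by simp))
      refine ⟨h2, hL2, fun z hz => hZ2 z ?_⟩
      simp only [Finset.coe_insert, mem_union, mem_insert_iff] at hz ⊢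
      tauto
  obtain ⟨h', hL', hZ'⟩ := key p.roots.toFinset (by simp [hp0])
  refine ⟨h', hL', fun y => ?_⟩
  set Z : Set ℝ := Z1 ∪ (p.roots.toFinset : Set ℝ) with hZdef
  by_cases hy : y ∈ Z
  · exact hZ' y hy
  obtain ⟨a, ha, b, hb, hyab, hgap⟩ := exists_gap (Z := Z)
    (hZ1.union (Finset.finite_toSet _).isClosed)
    (fun r => ⟨min A (r - 1), Or.inl (Or.inr (Or.inl (mem_Iic.2 (min_le_left _ _)))),
      (min_le_right _ _).trans_lt (by linarith)⟩)
    (fun r => ⟨max B (r + 1), Or.inl (Or.inr (Or.inr (mem_Ici.2 (le_max_left _ _)))),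
      lt_of_lt_of_le (by linarith) (le_max_right _ _)⟩) hy
  have hab := hyab.1.trans hyab.2
  have hne : ∀ y ∈ Ioo a b, p.derivative.eval y ≠ 0 := fun y hy h0 =>
    hgap y (Or.inl (Or.inl (mem_biUnion hd ⟨hd0, h0⟩))) hy
  have hne' : ∀ w ∈ Ioo (h' a) (h' b), P.derivative.eval w ≠ 0 := by
    intro w hw h0
    refine hne (h'.symm w) ⟨?_, ?_⟩ ?_
    · exact h'.lt_iff_lt.1 (by simpa using hw.1)
    · exact h'.lt_iff_lt.1 (by simpa using hw.2)
    · refine (sign_eq_zero_iff' (hL' _ hd (h'.symm w))).2 ?_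
      simpa using h0
  have h1 : 0 ≤ p.eval a * p.eval b := by
    by_contra hcon
    obtain ⟨v, hv, hv0⟩ := exists_root_Ioo p hab (not_le.1 hcon)
    exact hgap v (Or.inr (by simp [hp0, hv0])) hv
  have h2 : 0 ≤ P.eval (h' a) * P.eval (h' b) := by
    by_contra hcon
    refine (not_lt.2 h1) ((sign_neg_iff ?_).2 (not_le.1 hcon))
    rw [sign_mul, sign_mul, hZ' a ha, hZ' b hb]
  rw [sign_in_gap p hyab hne h1, sign_in_gap P ⟨h'.strictMono hyab.1, h'.strictMono hyab.2⟩
    hne' h2, hZ' a ha, hZ' b hb]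


section Elimination

variable {A : Type*} [CommRing A]

/-- One reduction step of `p` (of degree at most `n`) by the truncation of `q` in degree `d`. -/
noncomputable def reduceStep (n d : ℕ) (p q : A[X]) : A[X] :=
  C (q.coeff d ^ 2) * p -
    C (q.coeff d * p.coeff n) * (X ^ (n - d) * ∑ i ∈ Finset.range (d + 1), C (q.coeff i) * X ^ i)

theorem coeff_trunc (q : A[X]) (d k : ℕ) :
    (∑ i ∈ Finset.range (d + 1), C (q.coeff i) * X ^ i).coeff k =
      if k ≤ d then q.coeff k else 0 := by
  simp [finsetSum_coeff, coeff_C_mul, coeff_X_pow]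

theorem degree_reduceStep {n d : ℕ} (hd : d ≤ n) {p q : A[X]} (hp : p.degree < (n + 1 : ℕ)) :
    (reduceStep n d p q).degree < n := by
  rw [degree_lt_iff_coeff_zero] at hp ⊢
  intro m hm
  rw [reduceStep, coeff_sub, coeff_C_mul, coeff_C_mul, coeff_X_pow_mul', coeff_trunc,
    if_pos (by omega)]
  rcases hm.eq_or_lt with rfl | hm
  · rw [if_pos (by omega), Nat.sub_sub_self hd]; ring
  · rw [hp m hm, if_neg (by omega)]; ring

theorem eval_reduceStep (φ : A →+* ℝ) {n d : ℕ} {p q : A[X]}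
    (hq : ∀ k, d < k → φ (q.coeff k) = 0) {y : ℝ} (hy : (q.map φ).eval y = 0) :
    ((reduceStep n d p q).map φ).eval y = φ (q.coeff d) ^ 2 * (p.map φ).eval y := by
  have : (∑ i ∈ Finset.range (d + 1), C (q.coeff i) * X ^ i).map φ = q.map φ := by
    ext k
    rw [coeff_map, coeff_trunc, coeff_map]
    split_ifs with h
    · rfl
    · rw [hq k (by omega), map_zero]
  simp only [reduceStep, Polynomial.map_sub, Polynomial.map_mul, this, map_C, eval_sub, eval_mul,
    hy, eval_C, map_pow, Polynomial.map_pow, eval_pow]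
  ring

/-- For finitely many polynomials with coefficients in `A` there are finitely many elements
of `A` whose signs determine the arrangement on the line of the signs of the polynomials. -/
theorem exists_finite_match (n : ℕ) : ∀ G : Set A[X], G.Finite → (∀ q ∈ G, q.degree < n) →
    ∃ C : Set A, C.Finite ∧ ∀ φ ψ : A →+* ℝ,
      (∀ c ∈ C, SignType.sign (φ c) = SignType.sign (ψ c)) →
      ∃ h : ℝ ≃o ℝ, ∀ q ∈ G, SignMatch h (q.map φ) (q.map ψ) := by
  induction n with
  | zero =>
    intro G _ hG
    refine ⟨∅, finite_empty, fun φ ψ _ => ⟨OrderIso.refl ℝ, fun q hq => ?_⟩⟩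
    have : q = 0 := by
      have := hG q hq
      simpa [Nat.WithBot.lt_zero_iff] using this
    subst this
    intro y; simp
  | succ n ihn =>
    have main : ∀ H : Set A[X], H.Finite → (∀ q ∈ H, q.degree < (n + 1 : ℕ)) →
        ∀ G : Set A[X], G.Finite → (∀ q ∈ G, q.degree < n) →
        ∃ C : Set A, C.Finite ∧ ∀ φ ψ : A →+* ℝ,
          (∀ c ∈ C, SignType.sign (φ c) = SignType.sign (ψ c)) →
          ∃ h : ℝ ≃o ℝ, ∀ q ∈ H ∪ G, SignMatch h (q.map φ) (q.map ψ) := by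
      intro H hH
      induction H, hH using Set.Finite.induction_on with
      | empty =>
        intro _ G hG hG'
        simpa using ihn G hG hG'
      | @insert p H _ hH ih =>
        intro hdeg G hG hG'
        have hp : p.degree < (n + 1 : ℕ) := hdeg p (by simp)
        have hdp : (derivative p).degree < n := by
          rw [degree_lt_iff_coeff_zero] at hp ⊢
          intro m hm
          rw [coeff_derivative, hp (m + 1) (by omega), zero_mul]
        let E : Set A[X] := insert (derivative p) (H ∪ G)
        have hE : E.Finite := (hH.union hG).insert _
        have hEdeg : ∀ q ∈ E, q.degree < (n + 1 : ℕ) := by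
          have lt : ((n : ℕ) : WithBot ℕ) < (n + 1 : ℕ) := by exact_mod_cast Nat.lt_succ_self n
          rintro q (rfl | hq | hq)
          · exact hdp.trans lt
          · exact hdeg q (by simp [hq])
          · exact (hG' q hq).trans lt
        let N : Set A[X] := (fun x : ℕ × A[X] => reduceStep n x.1 p x.2) '' (Set.Iic n ×ˢ E)
        have hN : N.Finite := ((Set.finite_Iic n).prod hE).image _
        obtain ⟨C, hC, hC'⟩ := ih (fun q hq => hdeg q (by simp [hq]))
          (insert (derivative p) G ∪ N) ((hG.insert _).union hN) (by
            rintro q ((rfl | hq) | ⟨⟨d, e⟩, ⟨hd, _⟩, rfl⟩)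
            · exact hdp
            · exact hG' q hq
            · exact degree_reduceStep hd hp)
        let C1 : Set A := (fun x : ℕ × A[X] => x.2.coeff x.1) '' (Set.Iic n ×ˢ E)
        have hC1 : C1.Finite := ((Set.finite_Iic n).prod hE).image _
        refine ⟨insert (p.coeff 0) (C ∪ C1), (hC.union hC1).insert _, fun φ ψ hs => ?_⟩
        obtain ⟨h, hh⟩ := hC' φ ψ fun c hc => hs c (by simp [hc])
        have hhE : ∀ q ∈ E, SignMatch h (q.map φ) (q.map ψ) := by
          rintro q (rfl | hq | hq)
          · exact hh _ (by simp)
          · exact hh _ (by simp [hq])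
          · exact hh _ (by simp [hq])
        have hcoeff : ∀ q ∈ E, ∀ k, SignType.sign (φ (q.coeff k)) =
            SignType.sign (ψ (q.coeff k)) := by
          intro q hq k
          by_cases hk : k ≤ n
          · exact hs _ (Or.inr (Or.inr ⟨(k, q), ⟨hk, hq⟩, rfl⟩))
          · have := (degree_lt_iff_coeff_zero _ _).1 (hEdeg q hq) k (by omega)
            simp [this]
        have goal : ∃ h' : ℝ ≃o ℝ, (∀ q ∈ E, SignMatch h' (q.map φ) (q.map ψ)) ∧
            SignMatch h' (p.map φ) (p.map ψ) := by
          by_cases hd0 : derivative (p.map φ) = 0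
          · refine ⟨h, hhE, ?_⟩
            have hd1 : derivative (p.map ψ) = 0 := by
              have := hhE (derivative p) (by simp [E])
              rw [← derivative_map, ← derivative_map] at this
              exact (signMatch_zero this).1 hd0
            intro y
            rw [eq_C_of_derivative_eq_zero hd0, eq_C_of_derivative_eq_zero hd1]
            simpa using hs _ (by simp)
          · obtain ⟨h', h1, h2⟩ := match_extend
              (L := (fun q : A[X] => (q.map φ, q.map ψ)) '' E) (hE.image _)
              (p := p.map φ) (P := p.map ψ) (h := h)
              (by rintro _ ⟨q, hq, rfl⟩; exact hhE q hq)
              ⟨derivative p, by simp [E], by simp [derivative_map]⟩ hd0 (by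
                rintro _ ⟨q, hq, rfl⟩ hq0 y hy
                simp only at hq0 hy
                set d := (q.map φ).natDegree with hd
                have hdn : d ≤ n := by
                  have h1 : (q.map φ).degree < (n + 1 : ℕ) :=
                    degree_map_le.trans_lt (hEdeg q hq)
                  have := (natDegree_lt_iff_degree_lt hq0).2 h1
                  omega
                have hlead : φ (q.coeff d) ≠ 0 := by
                  rw [← coeff_map, hd]; exact leadingCoeff_ne_zero.2 hq0
                have hz : ∀ k, d < k → φ (q.coeff k) = 0 := fun k hk => by
                  rw [← coeff_map]; exact coeff_eq_zero_of_natDegree_lt hk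
                have hz' : ∀ k, d < k → ψ (q.coeff k) = 0 := fun k hk =>
                  (sign_eq_zero_iff' (hcoeff q hq k)).1 (hz k hk)
                have hlead' : ψ (q.coeff d) ≠ 0 := fun h0 =>
                  hlead ((sign_eq_zero_iff' (hcoeff q hq d)).2 h0)
                have hy' : (q.map ψ).eval (h y) = 0 :=
                  (sign_eq_zero_iff' (hhE q hq y)).1 hy
                have := hh (reduceStep n d p q)
                  (Or.inr (Or.inr ⟨(d, q), ⟨hdn, hq⟩, rfl⟩)) y
                rw [eval_reduceStep φ hz hy, eval_reduceStep ψ hz' hy', sign_mul, sign_mul,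
                  sign_pos (pow_two_pos_of_ne_zero hlead), sign_pos (pow_two_pos_of_ne_zero hlead'),
                  one_mul, one_mul] at this
                exact this)
            exact ⟨h', fun q hq => h1 _ ⟨q, hq, rfl⟩, h2⟩
        obtain ⟨h', h1, h2⟩ := goal
        refine ⟨h', ?_⟩
        rintro q ((rfl | hq) | hq)
        · exact h2
        · exact h1 q (by simp [E, hq])
        · exact h1 q (by simp [E, hq])
    intro G hG hG'
    simpa using main G hG hG' ∅ finite_empty (by simp)

end Elimination


end Semialg

namespace Semialg

open Set
open MvPolynomial (eval)

section Sets

variable {σ : Type*} {S T : Set (σ → ℝ)}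

theorem isSemialgebraic_iff : IsSemialgebraic S ↔
    ∃ F : Set (MvPolynomial σ ℝ), F.Finite ∧ ∀ x x' : σ → ℝ,
      (∀ q ∈ F, SignType.sign (eval x q) = SignType.sign (eval x' q)) → x ∈ S → x' ∈ S := by
  classical
  constructor
  · rintro ⟨𝒞, hfin, hb, rfl⟩
    choose! f g hfg using hb
    refine ⟨⋃ B ∈ 𝒞, insert (f B) (g B : Set (MvPolynomial σ ℝ)),
      hfin.biUnion fun B _ => (g B).finite_toSet.insert _, ?_⟩
    rintro x x' hs ⟨B, hB, hx⟩
    refine ⟨B, hB, ?_⟩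
    have hs' : ∀ q ∈ insert (f B) (g B : Set (MvPolynomial σ ℝ)),
        SignType.sign (eval x q) = SignType.sign (eval x' q) :=
      fun q hq => hs q (mem_biUnion hB hq)
    rw [hfg B hB] at hx ⊢
    refine ⟨(sign_eq_zero_iff' (hs' _ (by simp))).1 hx.1, fun q hq => ?_⟩
    rw [← sign_eq_one_iff, ← hs' q (by simp [hq]), sign_eq_one_iff]
    exact hx.2 q hq
  · rintro ⟨F, hF, hFS⟩
    lift F to Finset (MvPolynomial σ ℝ) using hF
    let cell : (F → SignType) → Set (σ → ℝ) := fun ε =>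
      {x | ∀ q : F, SignType.sign (eval x q.1) = ε q}
    have hcell : ∀ ε, IsBasicSemialgebraic (cell ε) := by
      intro ε
      refine ⟨∑ q : F, if ε q = 0 then q.1 ^ 2 else 0,
        Finset.univ.image fun q : F => if ε q = 0 then 1 else
          MvPolynomial.C ((ε q : SignType) : ℝ) * q.1, ?_⟩
      ext x
      have e1 : eval x (∑ q : F, if ε q = 0 then q.1 ^ 2 else 0) = 0 ↔
          ∀ q : F, ε q = 0 → eval x q.1 = 0 := by
        rw [map_sum, Finset.sum_eq_zero_iff_of_nonneg]
        · refine forall_congr' fun q => ?_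
          by_cases h : ε q = 0 <;> simp [h]
        · intro q _
          by_cases h : ε q = 0 <;> simp [h, sq_nonneg]
      have e2 : (∀ q ∈ Finset.univ.image (fun q : F => if ε q = 0 then 1 else
          MvPolynomial.C ((ε q : SignType) : ℝ) * q.1), 0 < eval x q) ↔
          ∀ q : F, ε q ≠ 0 → 0 < ((ε q : SignType) : ℝ) * eval x q.1 := by
        simp only [Finset.mem_image, Finset.mem_univ, true_and, forall_exists_index,
          forall_apply_eq_imp_iff]
        refine forall_congr' fun q => ?_
        by_cases h : ε q = 0 <;> simp [h]
      rw [mem_ofPred_eq, mem_ofPred_eq, e1, e2, ← forall_and]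
      refine forall_congr' fun q => ?_
      rcases h : ε q with _ | _ | _
      · simp [sign_eq_zero_iff]
      · simp [sign_eq_neg_one_iff]
      · simp [sign_eq_one_iff]
    refine ⟨cell '' ((fun x => fun q : F => SignType.sign (eval x q.1)) '' S),
      (Set.toFinite _).image _, ?_, ?_⟩
    · rintro _ ⟨ε, _, rfl⟩
      exact hcell ε
    · ext x
      constructor
      · intro hx
        exact ⟨_, ⟨_, ⟨x, hx, rfl⟩, rfl⟩, fun q => rfl⟩
      · rintro ⟨_, ⟨_, ⟨x', hx', rfl⟩, rfl⟩, hx⟩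
        exact hFS x' x (fun q hq => (hx ⟨q, hq⟩).symm) hx'

theorem _root_.IsSemialgebraic.preimage {τ : Type*} {S : Set (σ → ℝ)} (hS : IsSemialgebraic S)
    (P : σ → MvPolynomial τ ℝ) : IsSemialgebraic {x : τ → ℝ | (fun i => eval x (P i)) ∈ S} := by
  obtain ⟨F, hF, h⟩ := isSemialgebraic_iff.1 hS
  refine isSemialgebraic_iff.2 ⟨(MvPolynomial.bind₁ P) '' F, hF.image _, fun x x' hs hx => ?_⟩
  have e : ∀ (x : τ → ℝ) (q : MvPolynomial σ ℝ),
      eval x (MvPolynomial.bind₁ P q) = eval (fun i => eval x (P i)) q := by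
    intro x q
    induction q using MvPolynomial.induction_on with
    | C a => simp
    | add p q hp hq => simp [hp, hq]
    | mul_X p i hp => simp [hp]
  refine h _ _ (fun q hq => ?_) hx
  rw [← e, ← e]
  exact hs _ ⟨q, hq, rfl⟩

theorem _root_.IsSemialgebraic.inter (hS : IsSemialgebraic S) (hT : IsSemialgebraic T) :
    IsSemialgebraic (S ∩ T) := by
  obtain ⟨F, hF, h⟩ := isSemialgebraic_iff.1 hS
  obtain ⟨G, hG, h'⟩ := isSemialgebraic_iff.1 hT
  refine isSemialgebraic_iff.2 ⟨F ∪ G, hF.union hG, fun x x' hs hx => ⟨?_, ?_⟩⟩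
  · exact h x x' (fun q hq => hs q (Or.inl hq)) hx.1
  · exact h' x x' (fun q hq => hs q (Or.inr hq)) hx.2

theorem isSemialgebraic_zeros (f : MvPolynomial σ ℝ) : IsSemialgebraic {x | eval x f = 0} :=
  ⟨{{x | eval x f = 0}}, finite_singleton _, by
    rintro _ rfl
    exact ⟨f, ∅, by simp⟩, by simp⟩

/-- Projection along one coordinate. -/
theorem isSemialgebraic_exists_option {S : Set (Option σ → ℝ)} (hS : IsSemialgebraic S) :
    IsSemialgebraic {x : σ → ℝ | ∃ y : ℝ, (fun o : Option σ => o.elim y x) ∈ S} := by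
  obtain ⟨F, hF, h⟩ := isSemialgebraic_iff.1 hS
  let G : Set (Polynomial (MvPolynomial σ ℝ)) := MvPolynomial.optionEquivLeft ℝ σ '' F
  have hG : G.Finite := hF.image _
  obtain ⟨n, hn⟩ : ∃ n : ℕ, ∀ q ∈ G, q.degree < n := by
    obtain ⟨n, hn⟩ := (hG.image Polynomial.natDegree).bddAbove
    refine ⟨n + 1, fun q hq => lt_of_le_of_lt Polynomial.degree_le_natDegree ?_⟩
    exact_mod_cast Nat.lt_succ_of_le (hn ⟨q, hq, rfl⟩)
  obtain ⟨C, hC, hC'⟩ := exists_finite_match n G hG hn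
  refine isSemialgebraic_iff.2 ⟨C, hC, ?_⟩
  rintro x x' hs ⟨y, hy⟩
  obtain ⟨k, hk⟩ := hC' (eval x) (eval x') hs
  refine ⟨k y, h _ _ (fun q hq => ?_) hy⟩
  have e : ∀ (x : σ → ℝ) (y : ℝ), eval (fun o : Option σ => o.elim y x) q =
      ((MvPolynomial.optionEquivLeft ℝ σ q).map (eval x)).eval y := by
    intro x y
    clear hq
    induction q using MvPolynomial.induction_on with
    | C a => simp
    | add p q hp hq => simp [hp, hq]
    | mul_X p i hp => cases i <;> simp [hp]
  rw [e, e]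
  exact hk _ ⟨q, hq, rfl⟩ y

/-- Projection along finitely many coordinates. -/
theorem _root_.IsSemialgebraic.exists_sum (τ : Type) [Finite τ] : ∀ {σ : Type}
    {S : Set (σ ⊕ τ → ℝ)}, IsSemialgebraic S →
    IsSemialgebraic {x : σ → ℝ | ∃ y : τ → ℝ, Sum.elim x y ∈ S} := by
  induction τ using Finite.induction_empty_option with
  | @of_equiv α β e ih =>
    intro σ S hS
    convert ih (hS.preimage (fun i : σ ⊕ β => MvPolynomial.X (Sum.map id e.symm i))) using 1
    ext x
    constructor
    · rintro ⟨y, hy⟩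
      refine ⟨y ∘ e, ?_⟩
      simp only [mem_ofPred_eq] at hy ⊢
      convert hy using 2 with i
      rcases i with i | i <;> simp
    · rintro ⟨y, hy⟩
      refine ⟨y ∘ e.symm, ?_⟩
      simp only [mem_ofPred_eq] at hy ⊢
      convert hy using 2 with i
      rcases i with i | i <;> simp
  | h_empty =>
    intro σ S hS
    convert hS.preimage (fun i : σ ⊕ PEmpty => (MvPolynomial.X (i.elim id PEmpty.elim) :
      MvPolynomial σ ℝ)) using 1
    ext x
    constructor
    · rintro ⟨y, hy⟩
      simp only [mem_ofPred_eq] at hy ⊢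
      convert hy using 2 with i
      rcases i with i | i
      · simp
      · exact i.elim
    · intro hy
      refine ⟨PEmpty.elim, ?_⟩
      simp only [mem_ofPred_eq] at hy ⊢
      convert hy using 2 with i
      rcases i with i | i
      · simp
      · exact i.elim
  | @h_option α _ ih =>
    intro σ S hS
    have h1 := isSemialgebraic_exists_option (hS.preimage
      (fun i : σ ⊕ Option α => MvPolynomial.X (R := ℝ) (i.elim (fun s => some (Sum.inl s))
        (fun o => o.elim none fun a => some (Sum.inr a)))))
    convert ih h1 using 1
    ext x
    constructor
    · rintro ⟨y, hy⟩
      refine ⟨fun a => y (some a), y none, ?_⟩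
      simp only [mem_ofPred_eq] at hy ⊢
      convert hy using 2 with i
      rcases i with i | _ | i <;> simp
    · rintro ⟨y, y0, hy⟩
      refine ⟨fun o => o.elim y0 y, ?_⟩
      simp only [mem_ofPred_eq] at hy ⊢
      convert hy using 2 with i
      rcases i with i | _ | i <;> simp

end Sets

end Semialg

/-- The graph of a map from `M ⊆ ℝᵐ` to `ℝⁿ`, a subset of `ℝᵐ × ℝⁿ`. -/
def graphSet {m n : ℕ} {M : Set (Fin m → ℝ)} (f : M → Fin n → ℝ) : Set (Fin m ⊕ Fin n → ℝ) :=
  {z | ∃ x : M, z = Sum.elim (x : Fin m → ℝ) (f x)}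

/-- A semialgebraic map `M → N`: a continuous map with semialgebraic graph. -/
def IsSemialgebraicMap {m n : ℕ} {M : Set (Fin m → ℝ)} {N : Set (Fin n → ℝ)} (π : M → N) : Prop :=
  Continuous π ∧ IsSemialgebraic (graphSet fun x => (π x : Fin n → ℝ))

namespace Semialg

open Set
open MvPolynomial (eval)

theorem mem_graphSet {m n : ℕ} {M : Set (Fin m → ℝ)} {f : M → Fin n → ℝ} {z : Fin m ⊕ Fin n → ℝ} :
    z ∈ graphSet f ↔ ∃ x : M, (∀ i, z (Sum.inl i) = (x : Fin m → ℝ) i) ∧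
      ∀ j, z (Sum.inr j) = f x j := by
  refine exists_congr fun x => ⟨?_, fun h => ?_⟩
  · rintro rfl
    simp
  · ext (i | j)
    · exact h.1 i
    · exact h.2 j

theorem graph_poly {m : ℕ} {M : Set (Fin m → ℝ)} {f g k : M → ℝ}
    (hf : IsSemialgebraic (graphSet fun x (_ : Fin 1) => f x))
    (hg : IsSemialgebraic (graphSet fun x (_ : Fin 1) => g x)) (P : MvPolynomial (Fin 2) ℝ)
    (hk : ∀ x, k x = eval ![f x, g x] P) :
    IsSemialgebraic (graphSet fun x (_ : Fin 1) => k x) := by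
  have h1 := hf.preimage (fun i : Fin m ⊕ Fin 1 => (MvPolynomial.X
    (i.elim (fun j => Sum.inl (Sum.inl j)) fun _ => Sum.inr 0) :
      MvPolynomial ((Fin m ⊕ Fin 1) ⊕ Fin 2) ℝ))
  have h2 := hg.preimage (fun i : Fin m ⊕ Fin 1 => (MvPolynomial.X
    (i.elim (fun j => Sum.inl (Sum.inl j)) fun _ => Sum.inr 1) :
      MvPolynomial ((Fin m ⊕ Fin 1) ⊕ Fin 2) ℝ))
  have h3 := isSemialgebraic_zeros (MvPolynomial.X (Sum.inl (Sum.inr 0)) -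
    MvPolynomial.rename Sum.inr P : MvPolynomial ((Fin m ⊕ Fin 1) ⊕ Fin 2) ℝ)
  convert ((h1.inter h2).inter h3).exists_sum using 1
  ext z
  simp only [mem_graphSet, mem_ofPred_eq, mem_inter_iff, MvPolynomial.eval_X, Sum.elim_inl,
    Sum.elim_inr, map_sub, MvPolynomial.eval_rename, Fin.forall_fin_one, sub_eq_zero]
  constructor
  · rintro ⟨x, hx, hz⟩
    refine ⟨![f x, g x], ⟨⟨x, hx, by simp⟩, ⟨x, hx, by simp⟩⟩, ?_⟩
    rw [hz, hk]
    rfl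
  · rintro ⟨y, ⟨⟨x, hx, hy⟩, x', hx', hy'⟩, hz⟩
    have : x' = x := Subtype.ext (funext fun i => (hx' i).symm.trans (hx i))
    subst this
    refine ⟨x', hx, ?_⟩
    rw [hz, hk]
    congr 2
    ext i
    fin_cases i
    · exact hy
    · exact hy'

theorem graph_const {m : ℕ} {M : Set (Fin m → ℝ)} (hM : IsSemialgebraic M) (r : ℝ) :
    IsSemialgebraic (graphSet fun (_ : M) (_ : Fin 1) => r) := by
  have h1 := hM.preimage (fun i : Fin m => (MvPolynomial.X (Sum.inl i) :
    MvPolynomial (Fin m ⊕ Fin 1) ℝ))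
  have h2 := isSemialgebraic_zeros (MvPolynomial.X (Sum.inr 0) - MvPolynomial.C r :
    MvPolynomial (Fin m ⊕ Fin 1) ℝ)
  convert h1.inter h2 using 1
  ext z
  simp only [mem_graphSet, mem_ofPred_eq, mem_inter_iff, MvPolynomial.eval_X, map_sub,
    MvPolynomial.eval_C, Fin.forall_fin_one, sub_eq_zero]
  constructor
  · rintro ⟨x, hx, hz⟩
    exact ⟨by rw [funext hx]; exact x.2, hz⟩
  · rintro ⟨hx, hz⟩
    exact ⟨⟨_, hx⟩, fun _ => rfl, hz⟩

theorem graph_comp {m n k : ℕ} {M : Set (Fin m → ℝ)} {N : Set (Fin n → ℝ)} {π : M → N}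
    {f : N → Fin k → ℝ} (hπ : IsSemialgebraic (graphSet fun x => (π x : Fin n → ℝ)))
    (hf : IsSemialgebraic (graphSet f)) :
    IsSemialgebraic (graphSet fun x => f (π x)) := by
  have h1 := hπ.preimage (fun i : Fin m ⊕ Fin n => (MvPolynomial.X
    (i.elim (fun j => Sum.inl (Sum.inl j)) fun j => Sum.inr j) :
      MvPolynomial ((Fin m ⊕ Fin k) ⊕ Fin n) ℝ))
  have h2 := hf.preimage (fun i : Fin n ⊕ Fin k => (MvPolynomial.X
    (i.elim (fun j => Sum.inr j) fun j => Sum.inl (Sum.inr j)) :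
      MvPolynomial ((Fin m ⊕ Fin k) ⊕ Fin n) ℝ))
  convert (h1.inter h2).exists_sum using 1
  ext z
  simp only [mem_graphSet, mem_ofPred_eq, mem_inter_iff, MvPolynomial.eval_X, Sum.elim_inl,
    Sum.elim_inr]
  constructor
  · rintro ⟨x, hx, hz⟩
    exact ⟨π x, ⟨x, hx, fun _ => rfl⟩, π x, fun _ => rfl, hz⟩
  · rintro ⟨y, ⟨x, hx, hy⟩, x', hx', hz⟩
    have : x' = π x := Subtype.ext (funext fun i => (hx' i).symm.trans (hy i))
    subst this
    exact ⟨x, hx, hz⟩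

end Semialg

/-- The ring `𝒮(M)` of (continuous) semialgebraic functions on a semialgebraic set `M ⊆ ℝᵐ`:
the continuous functions `M → ℝ` whose graph is a semialgebraic subset of `ℝᵐ × ℝ`. -/
def semialgebraicFunctions {m : ℕ} {M : Set (Fin m → ℝ)} (hM : IsSemialgebraic M) :
    Subalgebra ℝ C(M, ℝ) where
  carrier := {f | IsSemialgebraic (graphSet fun x (_ : Fin 1) => f x)}
  mul_mem' hf hg := Semialg.graph_poly hf hg (MvPolynomial.X 0 * MvPolynomial.X 1)
    fun x => by simp
  add_mem' hf hg := Semialg.graph_poly hf hg (MvPolynomial.X 0 + MvPolynomial.X 1)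
    fun x => by simp
  algebraMap_mem' r := Semialg.graph_const hM r

section Spectral

variable {m n : ℕ} {M : Set (Fin m → ℝ)} {N : Set (Fin n → ℝ)}
  (hM : IsSemialgebraic M) (hN : IsSemialgebraic N)

/-- The homomorphism `φ_π : 𝒮(N) → 𝒮(M)`, `f ↦ f ∘ π`, induced by a semialgebraic map `π`. -/
def semialgebraicPullback {π : M → N} (hπ : IsSemialgebraicMap π) :
    semialgebraicFunctions hN →ₐ[ℝ] semialgebraicFunctions hM where
  toFun f := ⟨f.1.comp ⟨π, hπ.1⟩, Semialg.graph_comp hπ.2 f.2⟩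
  map_one' := rfl
  map_mul' _ _ := rfl
  map_zero' := rfl
  map_add' _ _ := rfl
  commutes' _ := rfl

/-- `Spec_s(M)`: the prime spectrum of `𝒮(M)` with the Zariski topology. -/
abbrev SpecS : Type := PrimeSpectrum (semialgebraicFunctions hM)

/-- `Spec_s(π) : Spec_s(M) → Spec_s(N)`, `𝔭 ↦ φ_π⁻¹(𝔭)`. -/
def specSMap {π : M → N} (hπ : IsSemialgebraicMap π) : SpecS hM → SpecS hN :=
  PrimeSpectrum.comap (semialgebraicPullback hM hN hπ).toRingHom

/-- `β_s M`: the set of maximal ideals of `𝒮(M)`, as a subspace of `Spec_s(M)`. -/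
def betaS : Set (SpecS hM) := {p | p.asIdeal.IsMaximal}

/-- Evaluation `𝒮(M) → ℝ` at a point of `M`. -/
def semialgebraicEval (x : M) : semialgebraicFunctions hM →+* ℝ :=
  (Pi.evalRingHom (fun _ : M => ℝ) x).comp
    (ContinuousMap.coeFnRingHom.comp (semialgebraicFunctions hM).val.toRingHom)

theorem ker_semialgebraicEval_isMaximal (x : M) :
    (RingHom.ker (semialgebraicEval hM x)).IsMaximal :=
  RingHom.ker_isMaximal_of_surjective _
    fun r => ⟨algebraMap ℝ (semialgebraicFunctions hM) r, rfl⟩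

/-- `j_M : M → β_s M`, sending `x` to the maximal ideal `𝔪_x = {f ∈ 𝒮(M) : f(x) = 0}`. -/
def betaSEmb (x : M) : betaS hM :=
  ⟨⟨RingHom.ker (semialgebraicEval hM x), (ker_semialgebraicEval_isMaximal hM x).isPrime⟩,
    ker_semialgebraicEval_isMaximal hM x⟩

end Spectral

/-! Assertions (1) and the maximality in (2) are commutative algebra, valid for any integral
homomorphism `R → S`. The map on spectra is closed, and the fiber over `q` is the spectrum of `κ(q)
⊗ S`, which is integral over a field. That ring is zero-dimensional, so the fiber is compact and
Hausdorff. A prime of `S` is maximal exactly when its contraction is, so `β_s M` is the full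
preimage of `β_s N`, and properness passes to the restriction.

Uniqueness in (2) needs the points of `M` to be dense in `β_s M` (`denseRange_betaSEmb`) and `β_s N`
to be Hausdorff (`t2Space_betaS`). The latter holds because `𝒮(N)` contains absolute values and
inverts zero-free functions.

For (3), every `f ∈ 𝒮(M)` satisfies at each `x` a monic equation with coefficients evaluated at `π
x`. Thus `f` takes finitely many values on a fiber and stays bounded wherever `π` converges. Applied
to coordinates, this gives finite fibers and limits in `ℝᵐ`. A limit `a ∉ M` is impossible, since
`1/‖x - a‖²` would be an unbounded element of `𝒮(M)`. -/

namespace Semialg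

open Set Filter Topology
open MvPolynomial (eval)

/-! ### Semialgebraic graphs of inverses, absolute values and coordinates -/

/-- A function defined from a semialgebraic one by a polynomial equation with one auxiliary
variable has a semialgebraic graph. -/
theorem graph_of_zeros {m : ℕ} {M : Set (Fin m → ℝ)} {f k : M → ℝ}
    (hf : IsSemialgebraic (graphSet fun x (_ : Fin 1) => f x)) (P : MvPolynomial (Fin 3) ℝ)
    (hk : ∀ x r, r = k x ↔ ∃ t, eval ![f x, r, t] P = 0) :
    IsSemialgebraic (graphSet fun x (_ : Fin 1) => k x) := by
  have h1 := hf.preimage (fun i : Fin m ⊕ Fin 1 => (MvPolynomial.X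
    (i.elim (fun j => Sum.inl (Sum.inl j)) fun _ => Sum.inr 0) :
      MvPolynomial ((Fin m ⊕ Fin 1) ⊕ Fin 2) ℝ))
  -- The three variables of `P` are the value of `f`, the last graph coordinate `r`, and `t`; the
  -- first and third are projected away.
  have h2 := isSemialgebraic_zeros (MvPolynomial.rename
    (![Sum.inr 0, Sum.inl (Sum.inr 0), Sum.inr 1] : Fin 3 → (Fin m ⊕ Fin 1) ⊕ Fin 2) P)
  convert (h1.inter h2).exists_sum using 1
  ext z
  have e : ∀ y : Fin 2 → ℝ, (Sum.elim z y : (Fin m ⊕ Fin 1) ⊕ Fin 2 → ℝ) ∘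
      (![Sum.inr 0, Sum.inl (Sum.inr 0), Sum.inr 1] : Fin 3 → (Fin m ⊕ Fin 1) ⊕ Fin 2) =
      ![y 0, z (Sum.inr 0), y 1] := by
    intro y
    ext i
    fin_cases i <;> rfl
  simp only [mem_graphSet, mem_ofPred_eq, mem_inter_iff, MvPolynomial.eval_X, Sum.elim_inl,
    Sum.elim_inr, MvPolynomial.eval_rename, Fin.forall_fin_one, e]
  constructor
  · rintro ⟨x, hx, hz⟩
    obtain ⟨t, ht⟩ := (hk x _).1 hz
    exact ⟨![f x, t], ⟨x, hx, by simp⟩, by simpa using ht⟩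
  · rintro ⟨y, ⟨x, hx, hy⟩, hz⟩
    exact ⟨x, hx, (hk x _).2 ⟨y 1, by rw [← hy]; exact hz⟩⟩

theorem graph_inv {m : ℕ} {M : Set (Fin m → ℝ)} {f : M → ℝ}
    (hf : IsSemialgebraic (graphSet fun x (_ : Fin 1) => f x)) (h0 : ∀ x, f x ≠ 0) :
    IsSemialgebraic (graphSet fun x (_ : Fin 1) => (f x)⁻¹) := by
  refine graph_of_zeros hf (MvPolynomial.X 0 * MvPolynomial.X 1 - 1) fun x r => ?_
  simp only [map_sub, map_mul, MvPolynomial.eval_X, map_one, exists_const, sub_eq_zero,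
    Matrix.cons_val_zero, Matrix.cons_val_one]
  exact ⟨fun h => h ▸ mul_inv_cancel₀ (h0 x), eq_inv_of_mul_eq_one_right⟩

theorem graph_abs {m : ℕ} {M : Set (Fin m → ℝ)} {f : M → ℝ}
    (hf : IsSemialgebraic (graphSet fun x (_ : Fin 1) => f x)) :
    IsSemialgebraic (graphSet fun x (_ : Fin 1) => |f x|) := by
  -- The sum of squares encodes `r² = f²` together with `r = t²`, the latter expressing `r ≥ 0`.
  refine graph_of_zeros hf ((MvPolynomial.X 1 ^ 2 - MvPolynomial.X 0 ^ 2) ^ 2 +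
    (MvPolynomial.X 1 - MvPolynomial.X 2 ^ 2) ^ 2) fun x r => ?_
  have e : ∀ a b : ℝ, a ^ 2 + b ^ 2 = 0 ↔ a = 0 ∧ b = 0 := fun a b => by
    rw [add_eq_zero_iff_of_nonneg (sq_nonneg a) (sq_nonneg b)]; simp
  simp only [map_sub, map_add, map_pow, MvPolynomial.eval_X, Matrix.cons_val, e, sub_eq_zero]
  constructor
  · rintro rfl
    exact ⟨√|f x|, sq_abs _, (Real.sq_sqrt (abs_nonneg _)).symm⟩
  · rintro ⟨t, h1, h2⟩
    rw [← abs_of_nonneg (h2 ▸ sq_nonneg t : 0 ≤ r)]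
    exact sq_eq_sq_iff_abs_eq_abs _ _ |>.1 h1

theorem graph_coord {m : ℕ} {M : Set (Fin m → ℝ)} (hM : IsSemialgebraic M) (i : Fin m) :
    IsSemialgebraic (graphSet fun (x : M) (_ : Fin 1) => (x : Fin m → ℝ) i) := by
  have h1 := hM.preimage (fun i : Fin m => (MvPolynomial.X (Sum.inl i) :
    MvPolynomial (Fin m ⊕ Fin 1) ℝ))
  have h2 := isSemialgebraic_zeros (MvPolynomial.X (Sum.inr 0) - MvPolynomial.X (Sum.inl i) :
    MvPolynomial (Fin m ⊕ Fin 1) ℝ)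
  convert h1.inter h2 using 1
  ext z
  simp only [mem_graphSet, mem_ofPred_eq, mem_inter_iff, MvPolynomial.eval_X, map_sub,
    Fin.forall_fin_one, sub_eq_zero]
  constructor
  · rintro ⟨x, hx, hz⟩
    exact ⟨by rw [funext hx]; exact x.2, by rw [hz, hx]⟩
  · rintro ⟨hx, hz⟩
    exact ⟨⟨_, hx⟩, fun _ => rfl, hz⟩

/-! ### Algebra of `𝒮(M)` and topology of `β_s M` -/

section Functions

variable {m : ℕ} {M : Set (Fin m → ℝ)} (hM : IsSemialgebraic M)

theorem semialgebraicEval_apply (x : M) (f : semialgebraicFunctions hM) :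
    semialgebraicEval hM x f = f.1 x := rfl

/-- The `i`-th coordinate as a semialgebraic function. -/
def coord (i : Fin m) : semialgebraicFunctions hM :=
  ⟨⟨fun x => (x : Fin m → ℝ) i, (continuous_apply i).comp continuous_subtype_val⟩, graph_coord hM i⟩

variable {hM}

/-- The inverse of a nowhere vanishing semialgebraic function. -/
noncomputable def inv (f : semialgebraicFunctions hM) (hf : ∀ x, f.1 x ≠ 0) :
    semialgebraicFunctions hM :=
  ⟨⟨fun x => (f.1 x)⁻¹, f.1.continuous.inv₀ hf⟩, graph_inv f.2 hf⟩

/-- The absolute value of a semialgebraic function. -/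
def absVal (f : semialgebraicFunctions hM) : semialgebraicFunctions hM :=
  ⟨⟨fun x => |f.1 x|, f.1.continuous.abs⟩, graph_abs f.2⟩

/-- Consequently a proper ideal contains no function bounded below by a positive constant, which is
how non-membership is proved below. -/
theorem isUnit_of_ne_zero (f : semialgebraicFunctions hM) (hf : ∀ x, f.1 x ≠ 0) : IsUnit f :=
  IsUnit.of_mul_eq_one (inv f hf)
    (Subtype.ext (ContinuousMap.ext fun x => mul_inv_cancel₀ (hf x)))

/-- The difference of two comaximal elements has disjointly supported positive and negative
parts lying outside the respective maximal ideals. -/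
theorem exists_mul_eq_zero_of_mem {f : semialgebraicFunctions hM}
    {I J : Ideal (semialgebraicFunctions hM)} (hI : I ≠ ⊤) (hJ : J ≠ ⊤)
    (hfI : f ∈ I) (hfJ : 1 - f ∈ J) : ∃ a ∉ I, ∃ b ∉ J, a * b = 0 := by
  -- `d` is `1` modulo `I` and `-1` modulo `J`, so `|d| + d` and `|d| - d`, twice its positive and
  -- negative parts, are the natural separating pair.
  let d := 1 - 2 * f
  have key : ∀ g : semialgebraicFunctions hM, (∀ x, 0 ≤ g.1 x) →
      ∀ K : Ideal (semialgebraicFunctions hM), K ≠ ⊤ → 2 + g ∉ K := by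
    intro g hg K hK hmem
    refine hK (Ideal.eq_top_of_isUnit_mem _ hmem (isUnit_of_ne_zero _ fun x => ?_))
    have : (2 + g).1 x = 2 + g.1 x := rfl
    rw [this]
    linarith [hg x]
  refine ⟨absVal d + d, fun h => ?_, absVal d - d, fun h => ?_, ?_⟩
  -- If `|d| + d` were in `I`, then so would be `|d| + d + 4f = 2 + (|d| - d)`, a function that is
  -- at least `2` everywhere.
  · refine key (absVal d - d) (fun x => sub_nonneg.2 (le_abs_self (d.1 x))) I hI ?_
    have : 2 + (absVal d - d) = absVal d + d + 4 * f := by simp only [d]; ring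
    rw [this]
    exact I.add_mem h (I.mul_mem_left _ hfI)
  · refine key (absVal d + d) (fun x => neg_le_iff_add_nonneg.1 (neg_abs_le (d.1 x)) |>.trans_eq
      (add_comm _ _)) J hJ ?_
    have : 2 + (absVal d + d) = absVal d - d + 4 * (1 - f) := by simp only [d]; ring
    rw [this]
    exact J.add_mem h (J.mul_mem_left _ hfJ)
  · have : absVal d * absVal d = d * d :=
      Subtype.ext (ContinuousMap.ext fun x => abs_mul_abs_self (d.1 x))
    linear_combination this

/-- Distinct maximal ideals are comaximal, which yields `a ∉ p` and `b ∉ q` with `a * b = 0`. Every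
prime contains `a` or `b`, so the basic opens of `a` and `b` are disjoint. -/
theorem t2Space_betaS : T2Space (betaS hM) := by
  refine ⟨fun p q hpq => ?_⟩
  have hp : p.1.asIdeal.IsMaximal := p.2
  have hq : q.1.asIdeal.IsMaximal := q.2
  have hne : p.1.asIdeal ≠ q.1.asIdeal := fun h => hpq (Subtype.ext (PrimeSpectrum.ext h))
  obtain ⟨f, hf, g, hg, hfg⟩ := Submodule.mem_sup.1
    ((Ideal.eq_top_iff_one _).1 (Ideal.IsMaximal.coprime_of_ne hp hq hne))
  obtain ⟨a, ha, b, hb, hab⟩ := exists_mul_eq_zero_of_mem hp.ne_top hq.ne_top hf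
    (by rw [← hfg]; simpa using hg)
  refine ⟨_, _, (PrimeSpectrum.isOpen_basicOpen (a := a)).preimage continuous_subtype_val,
    (PrimeSpectrum.isOpen_basicOpen (a := b)).preimage continuous_subtype_val, ha, hb, ?_⟩
  refine Set.disjoint_left.2 fun r h1 h2 => ?_
  rcases r.1.2.mem_or_mem (hab ▸ r.1.asIdeal.zero_mem : a * b ∈ r.1.asIdeal) with h | h
  exacts [h1 h, h2 h]

/-- A basic open set containing a prime comes from some `f ≠ 0`; any `x` with `f x ≠ 0` gives a
point `𝔪_x` in it. -/
theorem denseRange_betaSEmb : DenseRange (betaSEmb hM) := by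
  intro p
  rw [mem_closure_iff_nhds]
  intro s hs
  obtain ⟨t, ht, hts⟩ := mem_nhds_subtype _ _ _ |>.1 hs
  obtain ⟨_, ⟨f, rfl⟩, hpf, hft⟩ :=
    PrimeSpectrum.isTopologicalBasis_basic_opens.mem_nhds_iff.1 ht
  have : ∃ x, f.1 x ≠ 0 := by
    by_contra! h
    have : f = 0 := Subtype.ext (ContinuousMap.ext h)
    exact hpf (this ▸ p.1.asIdeal.zero_mem)
  obtain ⟨x, hx⟩ := this
  exact ⟨betaSEmb hM x, hts (hft hx), x, rfl⟩

end Functions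

/-! ### Finite fibers and properness of `π` -/

section Integral

variable {m n : ℕ} {M : Set (Fin m → ℝ)} {N : Set (Fin n → ℝ)}
  {hM : IsSemialgebraic M} {hN : IsSemialgebraic N} {π : M → N} {hπ : IsSemialgebraicMap π}

/-- A function integral over `𝒮(N)` is pointwise a root of the specialised equation. -/
theorem exists_monic_isRoot {f : semialgebraicFunctions hM}
    (hf : (semialgebraicPullback hM hN hπ).toRingHom.IsIntegralElem f) :
    ∃ p : Polynomial (semialgebraicFunctions hN), p.Monic ∧
      ∀ x, (p.map (semialgebraicEval hN (π x))).IsRoot (f.1 x) := by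
  obtain ⟨p, hp, h⟩ := hf
  refine ⟨p, hp, fun x => ?_⟩
  have := congrArg (semialgebraicEval hM x) h
  rwa [Polynomial.hom_eval₂, map_zero, ← Polynomial.eval_map] at this

/-- The specialised coefficients depend only on `π x = y`, so all values on the fiber are roots of
one monic real polynomial. -/
theorem finite_image_fiber {f : semialgebraicFunctions hM}
    (hf : (semialgebraicPullback hM hN hπ).toRingHom.IsIntegralElem f) (y : N) :
    (f.1 '' (π ⁻¹' {y})).Finite := by
  obtain ⟨p, hp, h⟩ := exists_monic_isRoot hf
  refine (Polynomial.finite_setOfPred_isRoot (hp.map (semialgebraicEval hN y)).ne_zero).subset ?_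
  rintro _ ⟨x, rfl, rfl⟩
  exact h x

/-- The coefficients are continuous at `y`, hence eventually bounded along `l`, and Cauchy's bound
controls the roots of a monic polynomial by its coefficients. -/
theorem exists_eventually_abs_le {f : semialgebraicFunctions hM}
    (hf : (semialgebraicPullback hM hN hπ).toRingHom.IsIntegralElem f) {l : Filter M} {y : N}
    (hl : Tendsto π l (𝓝 y)) : ∃ B : ℝ, ∀ᶠ x in l, |f.1 x| ≤ B := by
  obtain ⟨p, hp, h⟩ := exists_monic_isRoot hf
  let c : ℕ → N → ℝ := fun i z => (p.coeff i).1 z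
  have hc : ∀ i, ∀ᶠ x in l, ‖c i (π x)‖₊ < ‖c i y‖₊ + 1 := fun i =>
    (((p.coeff i).1.continuous.nnnorm.tendsto y).comp hl).eventually_lt_const
      (lt_add_of_pos_right _ one_pos)
  -- The inner `+ 1` is slack for the variation of the coefficients near `y`; the outer one belongs
  -- to Cauchy's bound.
  refine ⟨((Finset.range p.natDegree).sup (fun i => ‖c i y‖₊ + 1) + 1 : NNReal), ?_⟩
  filter_upwards [(Filter.eventually_all_finset (Finset.range p.natDegree)).2 fun i _ => hc i]
    with x hx
  have hm := hp.map (semialgebraicEval hN (π x))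
  have h1 := (h x).norm_lt_cauchyBound hm.ne_zero
  rw [Polynomial.cauchyBound, hm.leadingCoeff, nnnorm_one, div_one,
    hp.natDegree_map (semialgebraicEval hN (π x))] at h1
  have h2 : ‖f.1 x‖₊ ≤ (Finset.range p.natDegree).sup (fun i => ‖c i y‖₊ + 1) + 1 := by
    refine h1.le.trans (add_le_add_left (Finset.sup_mono_fun fun i hi => ?_) _)
    rw [Polynomial.coeff_map]
    exact (hx i hi).le
  exact_mod_cast h2

/-- A point is determined by its coordinates, each of which takes finitely many values on the fiber.
-/
theorem finite_fiber (hint : (semialgebraicPullback hM hN hπ).toRingHom.IsIntegral) (y : N) :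
    (π ⁻¹' {y}).Finite := by
  refine Set.Finite.of_finite_image (f := fun x : M => (x : Fin m → ℝ)) ?_
    Subtype.val_injective.injOn
  refine (Set.Finite.pi' fun i => finite_image_fiber (hint (coord hM i)) y).subset ?_
  rintro _ ⟨x, hx, rfl⟩ i
  exact ⟨x, hx, rfl⟩

/-- Since `N` is Hausdorff, it suffices that an ultrafilter whose image under `π` converges in `N`
converges in `M`. Bounded coordinates give a limit in `ℝᵐ`; an inverse squared distance forces it
into `M`. -/
theorem isProperMap_of_isIntegral
    (hint : (semialgebraicPullback hM hN hπ).toRingHom.IsIntegral) : IsProperMap π := by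
  refine isProperMap_iff_ultrafilter_of_t2.2 ⟨hπ.1, fun 𝒰 y hy => ?_⟩
  have hlim : ∀ i, ∃ a : ℝ, Tendsto (fun x : M => (x : Fin m → ℝ) i) 𝒰 (𝓝 a) := by
    intro i
    obtain ⟨B, hB⟩ := exists_eventually_abs_le (hint (coord hM i)) hy
    obtain ⟨a, -, ha⟩ := (isCompact_Icc (a := -B) (b := B)).ultrafilter_le_nhds
      (𝒰.map fun x : M => (x : Fin m → ℝ) i)
      (le_principal_iff.2 (hB.mono fun x hx => abs_le.1 hx))
    exact ⟨a, ha⟩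
  choose a ha using hlim
  have ha' : Tendsto (fun x : M => (x : Fin m → ℝ)) 𝒰 (𝓝 a) := tendsto_pi_nhds.2 ha
  by_cases haM : a ∈ M
  · exact ⟨⟨a, haM⟩, tendsto_subtype_rng (f := id) |>.2 ha'⟩
  exfalso
  -- The squared distance to `a` vanishes nowhere on `M` but tends to `0` along `𝒰`. Its inverse
  -- lies in `𝒮(M)`, so integrality bounds it along `𝒰`, a contradiction.
  let s : semialgebraicFunctions hM :=
    ∑ i, (coord hM i - algebraMap ℝ (semialgebraicFunctions hM) (a i)) ^ 2
  have hs : ∀ x : M, s.1 x = ∑ i, ((x : Fin m → ℝ) i - a i) ^ 2 := by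
    intro x
    rw [← semialgebraicEval_apply, map_sum]
    rfl
  have hs0 : ∀ x : M, s.1 x ≠ 0 := by
    intro x h
    rw [hs, Finset.sum_eq_zero_iff_of_nonneg fun i _ => sq_nonneg _] at h
    refine haM ?_
    convert x.2 using 1
    ext i
    have := pow_eq_zero_iff two_ne_zero |>.1 (h i (Finset.mem_univ i))
    linarith
  have hs1 : Tendsto s.1 𝒰 (𝓝 0) := by
    have := tendsto_finsetSum Finset.univ fun i _ => ((ha i).sub_const (a i)).pow 2
    simpa [← hs] using this
  obtain ⟨B, hB⟩ := exists_eventually_abs_le (hint (inv s hs0)) hy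
  have h1 : Tendsto (fun x => |(s.1 x)⁻¹|) 𝒰 atTop :=
    tendsto_norm_cobounded_atTop.comp (tendsto_inv₀_nhdsNE_zero.comp
      (tendsto_nhdsWithin_iff.2 ⟨hs1, Eventually.of_forall hs0⟩))
  obtain ⟨x, hx, hx'⟩ := (hB.and (h1.eventually_gt_atTop B)).exists
  exact absurd hx (not_le.2 hx')

end Integral

end Semialg

/-! ### Spectra under integral ring homomorphisms -/

namespace PrimeSpectrum

/-- All primes are maximal, so some `f` lies in `p` but not in `q`. As `p` is also minimal, `f` is
nilpotent in the localization at `p`, so `s * f ^ n = 0` for some `s ∉ p`. The basic opens of `s`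
and `f` then separate `p` and `q`. -/
theorem t2Space_of_krullDimLE_zero {R : Type*} [CommRing R] [Ring.KrullDimLE 0 R] :
    T2Space (PrimeSpectrum R) := by
  refine ⟨fun p q hpq => ?_⟩
  obtain ⟨f, hfp, hfq⟩ : ∃ f ∈ p.asIdeal, f ∉ q.asIdeal := by
    by_contra! h
    have hp : p.asIdeal.IsMaximal := Ideal.IsPrime.isMaximal' p.2
    exact hpq (PrimeSpectrum.ext (hp.eq_of_le q.2.ne_top h))
  have : Ring.KrullDimLE 0 (Localization.AtPrime p.asIdeal) :=
    Ring.KrullDimLE.of_isLocalization p.asIdeal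
      (Ring.KrullDimLE.mem_minimalPrimes_iff.2 ⟨p.2, bot_le⟩) _
  obtain ⟨n, hn⟩ := Ring.KrullDimLE.isNilpotent_iff_mem_maximalIdeal.2
    ((IsLocalization.AtPrime.to_map_mem_maximal_iff (Localization.AtPrime p.asIdeal)
      p.asIdeal f).2 hfp)
  rw [← map_pow, IsLocalization.map_eq_zero_iff p.asIdeal.primeCompl] at hn
  obtain ⟨s, hs⟩ := hn
  refine ⟨_, _, isOpen_basicOpen (a := (s : R)), isOpen_basicOpen (a := f), s.2, hfq, ?_⟩
  refine Set.disjoint_left.2 fun r h1 h2 => ?_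
  rcases r.2.mem_or_mem (hs ▸ r.asIdeal.zero_mem) with h | h
  exacts [h1 h, h2 (r.2.mem_of_pow_mem _ h)]

/-- Every prime contracts to the zero ideal of `K`, which is maximal, and integrality lifts
maximality. -/
theorem krullDimLE_zero_of_isIntegral {K R : Type*} [Field K] [CommRing R] [Algebra K R]
    [Algebra.IsIntegral K R] : Ring.KrullDimLE 0 R := by
  refine Ring.KrullDimLE.mk₀ fun I hI => ?_
  refine Ideal.isMaximal_of_isIntegral_of_isMaximal_comap (R := K) I ?_
  have : (I.comap (algebraMap K R)).IsPrime := inferInstance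
  rw [(Ideal.eq_bot_or_top (I.comap (algebraMap K R))).resolve_right this.ne_top]
  exact Ideal.bot_isMaximal

variable {R S : Type*} [CommRing R] [CommRing S] {f : R →+* S}

/-- Integrality is needed only for closedness: each fiber is homeomorphic to the spectrum of a ring,
hence compact. -/
theorem isProperMap_comap_of_isIntegral (hf : f.IsIntegral) : IsProperMap (comap f) := by
  algebraize [f]
  refine isProperMap_iff_isClosedMap_and_compact_fibers.2
    ⟨continuous_comap f, isClosedMap_comap_of_isIntegral f hf, fun q => ?_⟩
  exact isCompact_iff_compactSpace.2 (preimageHomeomorphFiber R S q).symm.compactSpace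

/-- By base change the fiber ring is integral over the residue field of `q`, hence zero-dimensional.
-/
theorem t2Space_fiber_comap_of_isIntegral (hf : f.IsIntegral) (q : PrimeSpectrum R) :
    T2Space (comap f ⁻¹' {q}) := by
  algebraize [f]
  have : Ring.KrullDimLE 0 (q.asIdeal.Fiber S) :=
    krullDimLE_zero_of_isIntegral (K := q.asIdeal.ResidueField)
  have := t2Space_of_krullDimLE_zero (R := q.asIdeal.Fiber S)
  exact (preimageHomeomorphFiber R S q).symm.t2Space

theorem isMaximal_comap_iff_of_isIntegral (hf : f.IsIntegral) (p : PrimeSpectrum S) :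
    (comap f p).asIdeal.IsMaximal ↔ p.asIdeal.IsMaximal :=
  ⟨fun h => Ideal.isMaximal_of_isIntegral_of_isMaximal_comap' f hf p.asIdeal h,
    fun _ => Ideal.isMaximal_comap_of_isIntegral_of_isMaximal' f hf p.asIdeal⟩

end PrimeSpectrum

/-! ### The proposition -/

theorem mainTheorem5 {m n : ℕ} {M : Set (Fin m → ℝ)} {N : Set (Fin n → ℝ)}
    (hM : IsSemialgebraic M) (hN : IsSemialgebraic N)
    (π : M → N) (hπ : IsSemialgebraicMap π)
    (hint : (semialgebraicPullback hM hN hπ).toRingHom.IsIntegral) :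
    (IsProperMap (specSMap hM hN hπ) ∧
      ∀ q : SpecS hN, T2Space (specSMap hM hN hπ ⁻¹' {q})) ∧
    (∃ hmax : Set.MapsTo (specSMap hM hN hπ) (betaS hM) (betaS hN),
      IsProperMap (hmax.restrict (specSMap hM hN hπ) (betaS hM) (betaS hN)) ∧
      (∀ x : M, hmax.restrict (specSMap hM hN hπ) (betaS hM) (betaS hN) (betaSEmb hM x) =
        betaSEmb hN (π x)) ∧
      ∀ g : betaS hM → betaS hN, Continuous g →
        (∀ x : M, g (betaSEmb hM x) = betaSEmb hN (π x)) →
        g = hmax.restrict (specSMap hM hN hπ) (betaS hM) (betaS hN)) ∧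
    (IsProperMap π ∧ ∀ y : N, (π ⁻¹' {y}).Finite) := by
  have hproper : IsProperMap (specSMap hM hN hπ) :=
    PrimeSpectrum.isProperMap_comap_of_isIntegral hint
  -- Equality, not mere inclusion, matters: a proper map stays proper when restricted to the full
  -- preimage of a subspace.
  have hpre : betaS hM = specSMap hM hN hπ ⁻¹' betaS hN :=
    Set.ext fun p => (PrimeSpectrum.isMaximal_comap_iff_of_isIntegral hint p).symm
  have hmax : Set.MapsTo (specSMap hM hN hπ) (betaS hM) (betaS hN) := hpre.subset
  have hrestrict : IsProperMap (hmax.restrict (specSMap hM hN hπ) (betaS hM) (betaS hN)) :=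
    (hproper.restrictPreimage (betaS hN)).comp (Homeomorph.setCongr hpre).isProperMap
  have := Semialg.t2Space_betaS (hM := hN)
  refine ⟨⟨hproper, PrimeSpectrum.t2Space_fiber_comap_of_isIntegral hint⟩,
    -- Pulling back along `π` and evaluating at `x` is evaluating at `π x`, so the kernels agree
    -- definitionally.
    ⟨hmax, hrestrict, fun x => rfl, fun g hg h => ?_⟩,
    Semialg.isProperMap_of_isIntegral hint, Semialg.finite_fiber hint⟩
  -- Continuous maps into the Hausdorff space `β_s N` that agree on the dense image of `M` are
  -- equal.
  exact Semialg.denseRange_betaSEmb.equalizer hg hrestrict.continuous (funext h)
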